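/- Let $a\in\mathbb C$ with $\operatorname{Re} a>0$. The series $\zeta(s,a)=\sum_{k\ge 0}(k+a)^{-s}$ ($\operatorname{Re} s>1$, principal powers) has an analytic continuation to $\mathbb C\setminus\{1\}$, again denoted $\zeta(s,a)$ (the Hurwitz zeta function). Write $\zeta'(s,a)=\partial_s\zeta(s,a)$, $\psi=\Gamma'/\Gamma$, and $g(n,a)=\zeta'(-n,a)+\psi(n+1)\,\zeta(-n,a)$ for $n=0,1,2,\dots$. For $0<\varepsilon<2\pi$ let $L=L_\varepsilon$ be the Hankel contour that consists of the lower side ($\arg z=-\pi$) of the ray $(-\infty,-\varepsilon)$ traced from left to right, the circle $z=\varepsilon e^{i\theta}$ with $\theta$ increasing from $-\pi$ to $\pi$, and the upper side ($\arg z=\pi$) of the same ray traced from right to left. On $L$ put $\operatorname{Log} z=\log|z|+i\arg z$ with these arguments, and $z^{w}=e^{w\operatorname{Log} z}$ for $w\in\mathbb C$. Then for every $\varepsilon\in(0,2\pi)$ all the integrals below converge absolutely, and the following hold. 1. For $n=0,1,2,\dots$: $$\zeta(-n,a)=\frac{n!}{2\pi i}\int_L\frac{z^{-n-1}e^{az}}{1-e^z}\,dz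 .$$ 2. For $n=1,2,3,\dots$: $$\zeta(n+1,a)=\frac{(-1)^{n+1}}{2\pi i\,n!}\int_L\frac{z^{n}\,\operatorname{Log} z\;e^{az}}{1-e^z}\,dz .$$ 3. For every complex $s\ne 1,2,3,\dots$: $$\zeta'(s,a)+\psi(1-s)\,\zeta(s,a)=\frac{\Gamma(1-s)}{2\pi i}\int_L\frac{z^{s-1}e^{az}\operatorname{Log} z}{1-e^z}\,dz .$$ 4. In particular, for $n=0,1,2,\dots$: $$g(n,a)=\frac{n!}{2\pi i}\int_L\frac{z^{-n-1}e^{az}\operatorname{Log} z}{1-e^z}\,dz .$$ -/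

import Mathlib

namespace HankelZeta

/-- `Z` is an analytic continuation to `ℂ \ {1}` of the Hurwitz zeta function
`s ↦ ∑ 1 / (n + a) ^ s` (`Re s > 1`, principal powers). The value `Z 1` carries no information. -/
structure IsHurwitzContinuation (a : ℂ) (Z : ℂ → ℂ) : Prop where
  differentiableOn : DifferentiableOn ℂ Z {1}ᶜ
  hasSum : ∀ s : ℂ, 1 < s.re → HasSum (fun n : ℕ => 1 / ((n : ℂ) + a) ^ s) (Z s)

/-- The continuation is unique away from `s = 1`. -/
theorem IsHurwitzContinuation.eqOn {a : ℂ} {Z W : ℂ → ℂ}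
    (hZ : IsHurwitzContinuation a Z) (hW : IsHurwitzContinuation a W) :
    Set.EqOn Z W {1}ᶜ := by
  have hc : IsPreconnected ({1}ᶜ : Set ℂ) :=
    (isConnected_compl_singleton_of_one_lt_rank (by simp) (1 : ℂ)).isPreconnected
  have hO : IsOpen ({1}ᶜ : Set ℂ) := isOpen_compl_singleton
  have hR : IsOpen {s : ℂ | 1 < s.re} := isOpen_lt continuous_const Complex.continuous_re
  refine (hZ.differentiableOn.analyticOnNhd hO).eqOn_of_preconnected_of_eventuallyEq
    (hW.differentiableOn.analyticOnNhd hO) hc (z₀ := 2) (by simp) ?_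
  filter_upwards [hR.mem_nhds (show (2 : ℂ) ∈ {s : ℂ | 1 < s.re} by simp)] with s hs
  exact (hZ.hasSum s hs).unique (hW.hasSum s hs)

open Classical in
/-- The Hurwitz zeta function `ζ(s, a)`, `s ≠ 1`, as the analytic continuation in `s` of its
defining series (argument order: `a`, then `s`). -/
noncomputable def hurwitzZeta (a : ℂ) : ℂ → ℂ :=
  if h : ∃ Z : ℂ → ℂ, IsHurwitzContinuation a Z then h.choose else 0

/-- `g(n, a) = ζ'(-n, a) + ψ(n + 1) ζ(-n, a)`, the derivative being in the first variable of
`ζ(s, a)`. -/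
noncomputable def g (n : ℕ) (a : ℂ) : ℂ :=
  deriv (hurwitzZeta a) (-(n : ℂ)) +
    Complex.digamma ((n : ℂ) + 1) * hurwitzZeta a (-(n : ℂ))

/-- Integrals along the Hankel contour: the integrand `F z l` is a function of the point `z` of
the contour and of the value `l = Log z = log |z| + i arg z` there, where `arg z = -π` on the lower
side of the ray `(-∞, -ε)`, `arg z = π` on its upper side, and `-π ≤ arg z ≤ π` on the circle
`|z| = ε`. This predicate says that the integrals along the three pieces converge absolutely. -/
structure HankelIntegrable (ε : ℝ) (F : ℂ → ℂ → ℂ) : Prop where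
  lower : MeasureTheory.IntegrableOn
    (fun x : ℝ => F (-(x : ℂ)) ((Real.log x : ℂ) - Real.pi * Complex.I)) (Set.Ioi ε)
  circle : IntervalIntegrable
    (fun θ : ℝ => F ((ε : ℂ) * Complex.exp (θ * Complex.I))
      ((Real.log ε : ℂ) + θ * Complex.I)) MeasureTheory.volume (-Real.pi) Real.pi
  upper : MeasureTheory.IntegrableOn
    (fun x : ℝ => F (-(x : ℂ)) ((Real.log x : ℂ) + Real.pi * Complex.I)) (Set.Ioi ε)

/-- `∫_L F(z, Log z) dz` over the Hankel contour of radius `ε`: the lower side `z = -x` with `x`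
decreasing from `∞` to `ε` (so `dz = -dx`), then the circle `z = ε e^{iθ}` with `θ` increasing from
`-π` to `π`, then the upper side `z = -x` with `x` increasing from `ε` to `∞`. -/
noncomputable def hankelIntegral (ε : ℝ) (F : ℂ → ℂ → ℂ) : ℂ :=
  (∫ x in Set.Ioi ε, F (-(x : ℂ)) ((Real.log x : ℂ) - Real.pi * Complex.I))
  + (∫ θ in (-Real.pi)..Real.pi,
      F ((ε : ℂ) * Complex.exp (θ * Complex.I)) ((Real.log ε : ℂ) + θ * Complex.I)
        * ((ε : ℂ) * Complex.I * Complex.exp (θ * Complex.I)))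
  - (∫ x in Set.Ioi ε, F (-(x : ℂ)) ((Real.log x : ℂ) + Real.pi * Complex.I))

end HankelZeta

namespace HankelZeta

open Complex Filter Topology Set MeasureTheory Asymptotics

/-- The factor `exp (a z) / (1 - exp z)` common to the Hankel integrands. -/
noncomputable def kernel (a z : ℂ) : ℂ := exp (a * z) / (1 - exp z)

theorem one_sub_exp_ne_zero {z : ℂ} (h0 : z ≠ 0) (h : ‖z‖ < 2 * Real.pi) : 1 - exp z ≠ 0 := by
  intro he
  obtain ⟨n, hn⟩ := exp_eq_one_iff.1 (sub_eq_zero.1 he).symm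
  have hn0 : n ≠ 0 := by rintro rfl; simp at hn; exact h0 hn
  have h1 : (1 : ℝ) ≤ |(n : ℝ)| := by exact_mod_cast Int.one_le_abs hn0
  have h2 : ‖z‖ = |(n : ℝ)| * (2 * Real.pi) := by
    rw [hn]; simp [abs_of_pos Real.pi_pos]
  nlinarith [Real.pi_pos]

theorem one_sub_exp_neg_eq (x : ℝ) : 1 - exp (-(x : ℂ)) = ((1 - Real.exp (-x) : ℝ) : ℂ) := by
  push_cast; rfl

theorem one_sub_exp_neg_ne_zero {x : ℝ} (hx : 0 < x) : 1 - exp (-(x : ℂ)) ≠ 0 := by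
  rw [one_sub_exp_neg_eq, ofReal_ne_zero]
  have : Real.exp (-x) < 1 := by simpa using hx
  linarith

theorem differentiableAt_kernel (a : ℂ) {z : ℂ} (h : 1 - exp z ≠ 0) :
    DifferentiableAt ℂ (kernel a) z := by
  unfold kernel
  exact DifferentiableAt.div (by fun_prop) (by fun_prop) h

theorem continuousOn_kernel_neg (a : ℂ) :
    ContinuousOn (fun x : ℝ => kernel a (-(x : ℂ))) (Ioi 0) := fun x hx =>
  (ContinuousAt.comp (f := fun x : ℝ => -(x : ℂ)) (g := kernel a)
    (differentiableAt_kernel a (one_sub_exp_neg_ne_zero hx)).continuousAt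
    (by fun_prop)).continuousWithinAt

theorem norm_kernel_neg_le (a : ℂ) {x : ℝ} (hx : 0 < x) :
    ‖kernel a (-(x : ℂ))‖ ≤ (1 + x⁻¹) * Real.exp (-a.re * x) := by
  have h1 : Real.exp (-x) * (1 + x) ≤ 1 := by
    have := Real.add_one_le_exp x
    rw [Real.exp_neg, inv_mul_le_iff₀ (Real.exp_pos x)]; linarith
  have h2 : x / (1 + x) ≤ 1 - Real.exp (-x) := by
    rw [div_le_iff₀ (by linarith)]; nlinarith
  have h3 : 0 < x / (1 + x) := by positivity
  rw [kernel, norm_div, one_sub_exp_neg_eq, norm_exp, norm_real, Real.norm_eq_abs,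
    abs_of_pos (h3.trans_le h2), div_eq_mul_inv, mul_comm]
  have h4 : (a * -(x : ℂ)).re = -a.re * x := by simp
  rw [h4]
  gcongr
  calc (1 - Real.exp (-x))⁻¹ ≤ (x / (1 + x))⁻¹ := by gcongr
    _ = 1 + x⁻¹ := by field_simp; ring

theorem kernel_neg_isBigO_atTop (a : ℂ) :
    (fun x : ℝ => kernel a (-(x : ℂ))) =O[atTop] fun x : ℝ => Real.exp (-a.re * x) := by
  refine IsBigO.of_bound 2 ?_
  filter_upwards [eventually_ge_atTop 1] with x hx
  refine (norm_kernel_neg_le a (by linarith)).trans ?_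
  rw [Real.norm_eq_abs, Real.abs_exp]
  gcongr
  linarith [inv_le_one_of_one_le₀ hx]

theorem kernel_neg_isBigO_atTop_rpow {a : ℂ} (ha : 0 < a.re) (b : ℝ) :
    (fun x : ℝ => kernel a (-(x : ℂ))) =O[atTop] fun x : ℝ => x ^ b :=
  (kernel_neg_isBigO_atTop a).trans (isLittleO_exp_neg_mul_rpow_atTop ha b).isBigO

theorem kernel_neg_isBigO_zero {a : ℂ} (ha : 0 < a.re) :
    (fun x : ℝ => kernel a (-(x : ℂ))) =O[𝓝[>] 0] fun x : ℝ => x ^ (-1 : ℝ) := by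
  refine IsBigO.of_bound 2 ?_
  filter_upwards [Ioc_mem_nhdsGT (zero_lt_one (α := ℝ))] with x hx
  refine (norm_kernel_neg_le a hx.1).trans ?_
  rw [Real.rpow_neg_one, Real.norm_eq_abs, abs_of_pos (inv_pos.2 hx.1)]
  have h1 : 1 ≤ x⁻¹ := (one_le_inv₀ hx.1).2 hx.2
  have h2 : Real.exp (-a.re * x) ≤ 1 := by
    rw [Real.exp_le_one_iff]; nlinarith [hx.1]
  nlinarith [Real.exp_pos (-a.re * x)]

theorem locallyIntegrableOn_kernel_neg (a : ℂ) :
    LocallyIntegrableOn (fun x : ℝ => kernel a (-(x : ℂ))) (Ioi 0) :=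
  (continuousOn_kernel_neg a).locallyIntegrableOn measurableSet_Ioi

/-- The kernel on the negative axis, cut off at distance `ε` from the origin. -/
noncomputable def cutKernel (a : ℂ) (ε : ℝ) : ℝ → ℂ :=
  (Ioi ε).indicator fun x : ℝ => kernel a (-(x : ℂ))

theorem locallyIntegrableOn_cutKernel (a : ℂ) (ε : ℝ) :
    LocallyIntegrableOn (cutKernel a ε) (Ioi 0) := fun x hx => by
  obtain ⟨t, ht, h⟩ := locallyIntegrableOn_kernel_neg a x hx
  exact ⟨t, ht, h.indicator measurableSet_Ioi⟩

theorem cutKernel_isBigO_atTop {a : ℂ} (ha : 0 < a.re) (ε b : ℝ) :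
    cutKernel a ε =O[atTop] fun x : ℝ => x ^ b := by
  refine (kernel_neg_isBigO_atTop_rpow ha b).congr' ?_ EventuallyEq.rfl
  filter_upwards [eventually_gt_atTop ε] with x hx
  simp [cutKernel, hx]

theorem cutKernel_isBigO_zero (a : ℂ) {ε : ℝ} (hε : 0 < ε) (b : ℝ) :
    cutKernel a ε =O[𝓝[>] 0] fun x : ℝ => x ^ b := by
  refine (isBigO_zero (fun x : ℝ => x ^ b) (𝓝[>] (0 : ℝ)) (E' := ℂ)).congr' ?_ EventuallyEq.rfl
  filter_upwards [Ioo_mem_nhdsGT hε] with x hx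
  simp [cutKernel, hx.2.le]

theorem mellinConvergent_cutKernel {a : ℂ} (ha : 0 < a.re) {ε : ℝ} (hε : 0 < ε) (s : ℂ) :
    MellinConvergent (cutKernel a ε) s :=
  mellinConvergent_of_isBigO_rpow (a := s.re + 1) (b := s.re - 1)
    (locallyIntegrableOn_cutKernel a ε) (cutKernel_isBigO_atTop ha ε _) (by linarith)
    (cutKernel_isBigO_zero a hε _) (by linarith)

theorem mellin_cutKernel_hasDerivAt {a : ℂ} (ha : 0 < a.re) {ε : ℝ} (hε : 0 < ε) (s : ℂ) :
    MellinConvergent (fun t => Real.log t • cutKernel a ε t) s ∧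
      HasDerivAt (mellin (cutKernel a ε)) (mellin (fun t => Real.log t • cutKernel a ε t) s) s :=
  mellin_hasDerivAt_of_isBigO_rpow (a := s.re + 1) (b := s.re - 1)
    (locallyIntegrableOn_cutKernel a ε) (cutKernel_isBigO_atTop ha ε _) (by linarith)
    (cutKernel_isBigO_zero a hε _) (by linarith)

theorem mellinConvergent_kernel {a : ℂ} (ha : 0 < a.re) {s : ℂ} (hs : 1 < s.re) :
    MellinConvergent (fun x : ℝ => kernel a (-(x : ℂ))) s :=
  mellinConvergent_of_isBigO_rpow (a := s.re + 1) (b := 1)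
    (locallyIntegrableOn_kernel_neg a) (kernel_neg_isBigO_atTop_rpow ha _) (by linarith)
    (kernel_neg_isBigO_zero ha) hs

theorem differentiableAt_mellin_kernel {a : ℂ} (ha : 0 < a.re) {s : ℂ} (hs : 1 < s.re) :
    DifferentiableAt ℂ (mellin fun x : ℝ => kernel a (-(x : ℂ))) s :=
  mellin_differentiableAt_of_isBigO_rpow (a := s.re + 1) (b := 1)
    (locallyIntegrableOn_kernel_neg a) (kernel_neg_isBigO_atTop_rpow ha _) (by linarith)
    (kernel_neg_isBigO_zero ha) hs

theorem tendsto_mellin_cutKernel {a : ℂ} (ha : 0 < a.re) {s : ℂ} (hs : 1 < s.re) :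
    Tendsto (fun ε => mellin (cutKernel a ε) s) (𝓝[>] 0)
      (𝓝 (mellin (fun x : ℝ => kernel a (-(x : ℂ))) s)) := by
  have hi := mellinConvergent_kernel ha hs
  refine tendsto_integral_filter_of_dominated_convergence _ ?_ ?_ hi.norm ?_
  · filter_upwards [self_mem_nhdsWithin] with ε hε
    exact (mellinConvergent_cutKernel ha hε s).aestronglyMeasurable
  · refine Eventually.of_forall fun ε => ae_of_all _ fun t => ?_
    rw [norm_smul, norm_smul]
    exact mul_le_mul_of_nonneg_left (norm_indicator_le_norm_self _ _) (norm_nonneg _)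
  · filter_upwards [ae_restrict_mem measurableSet_Ioi] with t ht
    refine tendsto_const_nhds.congr' ?_
    filter_upwards [Ioo_mem_nhdsGT (show (0 : ℝ) < t from ht)] with ε hε
    simp [cutKernel, hε.2]

theorem hasSum_kernel_neg (a : ℂ) {x : ℝ} (hx : 0 < x) :
    HasSum (fun n : ℕ => exp (-((n + a) * x))) (kernel a (-(x : ℂ))) := by
  have h : ‖exp (-(x : ℂ))‖ < 1 := by simpa [norm_exp] using hx
  have h2 := (hasSum_geometric_of_norm_lt_one h).mul_left (exp (a * -(x : ℂ)))
  rw [← div_eq_mul_inv] at h2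
  have h3 (n : ℕ) : exp (a * -(x : ℂ)) * exp (-(x : ℂ)) ^ n = exp (-((n + a) * x)) := by
    rw [← exp_nat_mul, ← exp_add]; ring_nf
  simp only [h3] at h2
  exact h2

theorem integrableOn_rpow_mul_exp_neg_mul {σ r : ℝ} (hσ : 0 < σ) (hr : 0 < r) :
    IntegrableOn (fun t : ℝ => t ^ (σ - 1) * Real.exp (-(r * t))) (Ioi 0) := by
  refine not_imp_comm.1 integral_undef ?_
  rw [Real.integral_rpow_mul_exp_neg_mul_Ioi hσ hr]
  have := Real.Gamma_pos_of_pos hσ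
  positivity

theorem norm_cpow_mul_exp_neg_mul (s r : ℂ) {t : ℝ} (ht : 0 < t) :
    ‖(t : ℂ) ^ (s - 1) * exp (-(r * t))‖ = t ^ (s.re - 1) * Real.exp (-(r.re * t)) := by
  rw [norm_mul, norm_cpow_eq_rpow_re_of_pos ht, norm_exp]
  simp

theorem aestronglyMeasurable_cpow_mul_exp (s r : ℂ) :
    AEStronglyMeasurable (fun t : ℝ => (t : ℂ) ^ (s - 1) * exp (-(r * t)))
      (volume.restrict (Ioi 0)) := by
  refine ContinuousOn.aestronglyMeasurable (fun t ht => ?_) measurableSet_Ioi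
  refine ContinuousAt.continuousWithinAt (ContinuousAt.mul ?_ (by fun_prop))
  exact continuousAt_ofReal_cpow_const _ _ (Or.inr (ne_of_gt ht))

theorem integrableOn_cpow_mul_exp_neg_mul {s r : ℂ} (hs : 0 < s.re) (hr : 0 < r.re) :
    IntegrableOn (fun t : ℝ => (t : ℂ) ^ (s - 1) * exp (-(r * t))) (Ioi 0) := by
  refine Integrable.mono' (integrableOn_rpow_mul_exp_neg_mul hs hr)
    (aestronglyMeasurable_cpow_mul_exp s r) ?_
  filter_upwards [ae_restrict_mem measurableSet_Ioi] with t ht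
  rw [norm_cpow_mul_exp_neg_mul s r ht]

theorem differentiableAt_integral_cpow_mul_exp {s r : ℂ} (hs : 0 < s.re) (hr : 0 < r.re) :
    DifferentiableAt ℂ
      (fun r : ℂ => ∫ t : ℝ in Ioi 0, (t : ℂ) ^ (s - 1) * exp (-(r * t))) r := by
  have hU : {w : ℂ | r.re / 2 < w.re} ∈ 𝓝 r :=
    (isOpen_lt continuous_const continuous_re).mem_nhds (show r.re / 2 < r.re by linarith)
  refine (hasDerivAt_integral_of_dominated_loc_of_deriv_le (μ := volume.restrict (Ioi 0))
    (F := fun (w : ℂ) (t : ℝ) => (t : ℂ) ^ (s - 1) * exp (-(w * t)))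
    (F' := fun (w : ℂ) (t : ℝ) => (t : ℂ) ^ (s - 1) * exp (-(w * t)) * (-(t : ℂ)))
    (bound := fun t : ℝ => t ^ (s.re + 1 - 1) * Real.exp (-(r.re / 2 * t)))
    hU (Eventually.of_forall fun w => aestronglyMeasurable_cpow_mul_exp s w)
    (integrableOn_cpow_mul_exp_neg_mul hs hr)
    ((aestronglyMeasurable_cpow_mul_exp s r).mul
      (by fun_prop)) ?_
    (integrableOn_rpow_mul_exp_neg_mul (by linarith) (by linarith))
    ?_).2.differentiableAt
  · filter_upwards [ae_restrict_mem measurableSet_Ioi] with t ht w hw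
    have ht' : 0 < t := ht
    rw [norm_mul, norm_cpow_mul_exp_neg_mul s w ht, norm_neg, norm_real, Real.norm_eq_abs,
      abs_of_pos ht', add_sub_right_comm, Real.rpow_add_one ht'.ne', mul_right_comm]
    have hw' : r.re / 2 < w.re := hw
    gcongr
  · refine ae_of_all _ fun t w _ => ?_
    have h : HasDerivAt (fun w : ℂ => -(w * t)) (-(t : ℂ)) w := by
      simpa using! ((hasDerivAt_id w).mul_const (t : ℂ)).neg
    simpa [mul_assoc] using h.cexp.const_mul ((t : ℂ) ^ (s - 1))

/-- Euler's integral with a complex scaling parameter in the right half-plane. -/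
theorem integral_cpow_mul_exp_neg_mul_Ioi_of_re_pos {s r : ℂ} (hs : 0 < s.re) (hr : 0 < r.re) :
    ∫ t : ℝ in Ioi 0, (t : ℂ) ^ (s - 1) * exp (-(r * t)) = (1 / r) ^ s * Gamma s := by
  have hO : IsOpen {w : ℂ | 0 < w.re} := isOpen_lt continuous_const continuous_re
  have hc : IsPreconnected {w : ℂ | 0 < w.re} := (convex_halfSpace_re_gt 0).isPreconnected
  have h1 : AnalyticOnNhd ℂ
      (fun r : ℂ => ∫ t : ℝ in Ioi 0, (t : ℂ) ^ (s - 1) * exp (-(r * t))) {w : ℂ | 0 < w.re} :=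
    DifferentiableOn.analyticOnNhd (fun w hw =>
      (differentiableAt_integral_cpow_mul_exp hs hw).differentiableWithinAt) hO
  have h2 : AnalyticOnNhd ℂ (fun r : ℂ => (1 / r) ^ s * Gamma s) {w : ℂ | 0 < w.re} := by
    refine DifferentiableOn.analyticOnNhd (fun w hw => ?_) hO
    have hw0 : w ≠ 0 := by rintro rfl; simp at hw
    refine DifferentiableAt.differentiableWithinAt (DifferentiableAt.mul_const ?_ _)
    refine DifferentiableAt.cpow (by fun_prop (disch := assumption)) (by fun_prop) (Or.inl ?_)
    rw [one_div, inv_re]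
    exact div_pos hw (normSq_pos.2 hw0)
  refine h1.eqOn_of_preconnected_of_frequently_eq h2 hc (z₀ := 1) (by simp) ?_ hr
  have ht : Tendsto (fun x : ℝ => (x : ℂ)) (𝓝[>] 1) (𝓝[≠] 1) := by
    refine tendsto_nhdsWithin_iff.2 ⟨?_, ?_⟩
    · exact (continuous_ofReal.tendsto' 1 1 (by simp)).mono_left nhdsWithin_le_nhds
    · filter_upwards [self_mem_nhdsWithin] with x hx
      simpa using (ne_of_gt hx)
  refine ht.frequently (Eventually.frequently ?_)
  filter_upwards [self_mem_nhdsWithin] with x hx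
  exact integral_cpow_mul_exp_neg_mul_Ioi hs (zero_lt_one.trans hx)

theorem hasSum_mellin_kernel {a : ℂ} (ha : 0 < a.re) {s : ℂ} (hs : 1 < s.re) :
    HasSum (fun n : ℕ => Gamma s * (1 / ((n : ℂ) + a) ^ s))
      (mellin (fun x : ℝ => kernel a (-(x : ℂ))) s) := by
  have hs0 : 0 < s.re := by linarith
  have hre (n : ℕ) : ((n : ℂ) + a).re = n + a.re := by simp
  have hp (n : ℕ) : 0 < ((n : ℂ) + a).re := by rw [hre]; positivity
  have hint (n : ℕ) : IntegrableOn (fun t : ℝ => (t : ℂ) ^ (s - 1) * exp (-((n + a) * t)))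
      (Ioi 0) := integrableOn_cpow_mul_exp_neg_mul hs0 (hp n)
  have hterm (n : ℕ) : ∫ t : ℝ in Ioi 0, (t : ℂ) ^ (s - 1) * exp (-((n + a) * t)) =
      Gamma s * (1 / ((n : ℂ) + a) ^ s) := by
    rw [integral_cpow_mul_exp_neg_mul_Ioi_of_re_pos hs0 (hp n), one_div, one_div, inv_cpow, mul_comm]
    intro h
    have := hp n
    rw [arg_eq_pi_iff] at h
    linarith [h.1]
  have hsum : Summable fun n : ℕ =>
      ∫ t : ℝ in Ioi 0, ‖(t : ℂ) ^ (s - 1) * exp (-((n + a) * t))‖ := by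
    have heq (n : ℕ) : ∫ t : ℝ in Ioi 0, ‖(t : ℂ) ^ (s - 1) * exp (-((n + a) * t))‖ =
        (1 / ((n : ℝ) + a.re)) ^ s.re * Real.Gamma s.re := by
      rw [← Real.integral_rpow_mul_exp_neg_mul_Ioi hs0 (by positivity)]
      exact setIntegral_congr_fun measurableSet_Ioi fun t ht => by
        simpa using norm_cpow_mul_exp_neg_mul s (n + a) ht
    simp_rw [heq]
    refine Summable.mul_right _ ?_
    have h := Real.summable_one_div_nat_add_rpow a.re s.re |>.2 hs
    refine h.congr fun n => ?_
    rw [abs_of_pos (by positivity), Real.div_rpow zero_le_one (by positivity), Real.one_rpow]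
  have h := hasSum_integral_of_summable_integral_norm hint hsum
  simp_rw [hterm] at h
  have hm : mellin (fun x : ℝ => kernel a (-(x : ℂ))) s =
      ∫ t : ℝ in Ioi 0, ∑' n : ℕ, (t : ℂ) ^ (s - 1) * exp (-((n + a) * t)) := by
    refine setIntegral_congr_fun measurableSet_Ioi fun t ht => ?_
    simp only [smul_eq_mul]
    rw [tsum_mul_left, (hasSum_kernel_neg a ht).tsum_eq]
  rwa [hm]

theorem exp_log_add {x : ℝ} (hx : 0 < x) (c : ℂ) : exp ((Real.log x : ℂ) + c) = x * exp c := by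
  rw [exp_add, ← ofReal_exp, Real.exp_log hx]

theorem exp_log_sub_pi {x : ℝ} (hx : 0 < x) :
    exp ((Real.log x : ℂ) - Real.pi * I) = -(x : ℂ) := by
  rw [sub_eq_add_neg, exp_log_add hx, exp_neg, exp_pi_mul_I]; simp

theorem exp_log_add_pi {x : ℝ} (hx : 0 < x) :
    exp ((Real.log x : ℂ) + Real.pi * I) = -(x : ℂ) := by
  rw [exp_log_add hx, exp_pi_mul_I]; simp

/-- Only the values of the integrand at pairs `(exp l, l)` matter. -/
theorem HankelIntegrable.congr {ε : ℝ} (hε : 0 < ε) {F G : ℂ → ℂ → ℂ}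
    (h : ∀ l, F (exp l) l = G (exp l) l) (hF : HankelIntegrable ε F) : HankelIntegrable ε G where
  lower := hF.lower.congr_fun (fun x hx => by
    have := h ((Real.log x : ℂ) - Real.pi * I)
    rwa [exp_log_sub_pi (hε.trans hx)] at this) measurableSet_Ioi
  circle := by
    have h1 (θ : ℝ) := h ((Real.log ε : ℂ) + θ * I)
    simp only [exp_log_add hε] at h1
    simpa only [h1] using hF.circle
  upper := hF.upper.congr_fun (fun x hx => by
    have := h ((Real.log x : ℂ) + Real.pi * I)
    rwa [exp_log_add_pi (hε.trans hx)] at this) measurableSet_Ioi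

theorem hankelIntegral_congr {ε : ℝ} (hε : 0 < ε) {F G : ℂ → ℂ → ℂ}
    (h : ∀ l, F (exp l) l = G (exp l) l) : hankelIntegral ε F = hankelIntegral ε G := by
  have h1 (θ : ℝ) := h ((Real.log ε : ℂ) + θ * I)
  simp only [exp_log_add hε] at h1
  unfold hankelIntegral
  simp only [h1]
  congr 1
  · congr 1
    refine setIntegral_congr_fun measurableSet_Ioi fun x hx => ?_
    have := h ((Real.log x : ℂ) - Real.pi * I)
    rwa [exp_log_sub_pi (hε.trans hx)] at this
  · refine setIntegral_congr_fun measurableSet_Ioi fun x hx => ?_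
    have := h ((Real.log x : ℂ) + Real.pi * I)
    rwa [exp_log_add_pi (hε.trans hx)] at this

theorem exp_mul_log_add {x : ℝ} (hx : 0 < x) (w c : ℂ) :
    exp (w * ((Real.log x : ℂ) + c)) = exp (w * c) * (x : ℂ) ^ w := by
  rw [cpow_def_of_ne_zero (ofReal_ne_zero.2 hx.ne'), ← ofReal_log hx.le, ← exp_add]
  ring_nf

section Rays

variable {a : ℂ} {ε : ℝ}

theorem integrableOn_Ioi_cpow_mul_kernel (ha : 0 < a.re) (hε : 0 < ε) (s : ℂ) :
    IntegrableOn (fun x : ℝ => (x : ℂ) ^ (s - 1) * kernel a (-(x : ℂ))) (Ioi ε) :=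
  ((mellinConvergent_cutKernel ha hε s).mono_set (Ioi_subset_Ioi hε.le)).congr_fun
    (fun x hx => by simp [cutKernel, show ε < x from hx]) measurableSet_Ioi

theorem integrableOn_Ioi_cpow_mul_log_mul_kernel (ha : 0 < a.re) (hε : 0 < ε) (s : ℂ) :
    IntegrableOn (fun x : ℝ => (x : ℂ) ^ (s - 1) * (Real.log x * kernel a (-(x : ℂ))))
      (Ioi ε) :=
  ((mellin_cutKernel_hasDerivAt ha hε s).1.mono_set (Ioi_subset_Ioi hε.le)).congr_fun
    (fun x hx => by simp [cutKernel, show ε < x from hx]) measurableSet_Ioi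

theorem mellin_cutKernel_eq (a : ℂ) (hε : 0 < ε) (s : ℂ) :
    mellin (cutKernel a ε) s =
      ∫ x : ℝ in Ioi ε, (x : ℂ) ^ (s - 1) * kernel a (-(x : ℂ)) := by
  have h : ∀ x : ℝ, (x : ℂ) ^ (s - 1) • cutKernel a ε x =
      (Ioi ε).indicator (fun x : ℝ => (x : ℂ) ^ (s - 1) * kernel a (-(x : ℂ))) x := fun x => by
    by_cases hx : x ∈ Ioi ε <;> simp [cutKernel, hx]
  simp only [mellin, h]
  rw [setIntegral_indicator measurableSet_Ioi, Ioi_inter_Ioi, max_eq_right hε.le]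

theorem mellin_log_cutKernel_eq (a : ℂ) (hε : 0 < ε) (s : ℂ) :
    mellin (fun t => Real.log t • cutKernel a ε t) s =
      ∫ x : ℝ in Ioi ε, (x : ℂ) ^ (s - 1) * (Real.log x * kernel a (-(x : ℂ))) := by
  have h : ∀ x : ℝ, (x : ℂ) ^ (s - 1) • Real.log x • cutKernel a ε x =
      (Ioi ε).indicator
        (fun x : ℝ => (x : ℂ) ^ (s - 1) * (Real.log x * kernel a (-(x : ℂ)))) x := fun x => by
    by_cases hx : x ∈ Ioi ε <;> simp [cutKernel, hx]
  simp only [mellin, h]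
  rw [setIntegral_indicator measurableSet_Ioi, Ioi_inter_Ioi, max_eq_right hε.le]

theorem integrableOn_ray (ha : 0 < a.re) (hε : 0 < ε) (s c : ℂ) :
    IntegrableOn (fun x : ℝ => exp ((s - 1) * ((Real.log x : ℂ) + c)) * kernel a (-(x : ℂ)))
      (Ioi ε) :=
  IntegrableOn.congr_fun ((integrableOn_Ioi_cpow_mul_kernel ha hε s).const_mul (exp ((s - 1) * c)))
    (fun x hx => by simp only [exp_mul_log_add (hε.trans hx)]; ring) measurableSet_Ioi

theorem integral_ray (a : ℂ) (hε : 0 < ε) (s c : ℂ) :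
    ∫ x : ℝ in Ioi ε, exp ((s - 1) * ((Real.log x : ℂ) + c)) * kernel a (-(x : ℂ)) =
      exp ((s - 1) * c) * mellin (cutKernel a ε) s := by
  rw [mellin_cutKernel_eq a hε, ← integral_const_mul]
  refine setIntegral_congr_fun measurableSet_Ioi fun x hx => ?_
  simp only [exp_mul_log_add (hε.trans hx)]; ring

theorem integrableOn_log_ray (ha : 0 < a.re) (hε : 0 < ε) (s c : ℂ) :
    IntegrableOn (fun x : ℝ => exp ((s - 1) * ((Real.log x : ℂ) + c)) * ((Real.log x : ℂ) + c) *
      kernel a (-(x : ℂ))) (Ioi ε) :=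
  IntegrableOn.congr_fun
    (((integrableOn_Ioi_cpow_mul_kernel ha hε s).const_mul (exp ((s - 1) * c) * c)).add
      ((integrableOn_Ioi_cpow_mul_log_mul_kernel ha hε s).const_mul (exp ((s - 1) * c))))
    (fun x hx => by simp only [exp_mul_log_add (hε.trans hx), Pi.add_apply]; ring)
    measurableSet_Ioi

theorem integral_log_ray (ha : 0 < a.re) (hε : 0 < ε) (s c : ℂ) :
    ∫ x : ℝ in Ioi ε, exp ((s - 1) * ((Real.log x : ℂ) + c)) * ((Real.log x : ℂ) + c) *
      kernel a (-(x : ℂ)) =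
      exp ((s - 1) * c) * c * mellin (cutKernel a ε) s +
        exp ((s - 1) * c) * mellin (fun t => Real.log t • cutKernel a ε t) s := by
  rw [mellin_cutKernel_eq a hε, mellin_log_cutKernel_eq a hε, ← integral_const_mul,
    ← integral_const_mul, ← integral_add
      ((integrableOn_Ioi_cpow_mul_kernel ha hε s).const_mul _)
      ((integrableOn_Ioi_cpow_mul_log_mul_kernel ha hε s).const_mul _)]
  refine setIntegral_congr_fun measurableSet_Ioi fun x hx => ?_
  simp only [exp_mul_log_add (hε.trans hx)]; ring

theorem hasDerivAt_integral_ray (ha : 0 < a.re) (hε : 0 < ε) (s c : ℂ) :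
    HasDerivAt
      (fun s => ∫ x : ℝ in Ioi ε,
        exp ((s - 1) * ((Real.log x : ℂ) + c)) * kernel a (-(x : ℂ)))
      (∫ x : ℝ in Ioi ε, exp ((s - 1) * ((Real.log x : ℂ) + c)) * ((Real.log x : ℂ) + c) *
        kernel a (-(x : ℂ))) s := by
  simp only [integral_ray a hε, integral_log_ray ha hε]
  have h : HasDerivAt (fun s : ℂ => exp ((s - 1) * c)) (exp ((s - 1) * c) * c) s := by
    simpa using (((hasDerivAt_id s).sub_const 1).mul_const c).cexp
  exact h.mul (mellin_cutKernel_hasDerivAt ha hε s).2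

end Rays

section Circle

variable {a : ℂ} {ε : ℝ}

theorem circle_point_ne (hε : 0 < ε) (hε' : ε < 2 * Real.pi) (θ : ℝ) :
    1 - exp ((ε : ℂ) * exp (θ * I)) ≠ 0 := by
  refine one_sub_exp_ne_zero (mul_ne_zero (ofReal_ne_zero.2 hε.ne') (exp_ne_zero _)) ?_
  rw [norm_mul, norm_exp_ofReal_mul_I, norm_real, Real.norm_eq_abs, abs_of_pos hε, mul_one]
  exact hε'

theorem continuous_kernel_circle (a : ℂ) (hε : 0 < ε) (hε' : ε < 2 * Real.pi) :
    Continuous fun θ : ℝ => kernel a ((ε : ℂ) * exp (θ * I)) := by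
  unfold kernel
  exact Continuous.div (by fun_prop) (by fun_prop) (circle_point_ne hε hε')

theorem hasDerivAt_integral_circle (a : ℂ) (hε : 0 < ε) (hε' : ε < 2 * Real.pi) (s : ℂ) :
    HasDerivAt
      (fun s => ∫ θ : ℝ in (-Real.pi)..Real.pi,
        exp ((s - 1) * ((Real.log ε : ℂ) + θ * I)) * kernel a ((ε : ℂ) * exp (θ * I)) *
          ((ε : ℂ) * I * exp (θ * I)))
      (∫ θ : ℝ in (-Real.pi)..Real.pi,
        exp ((s - 1) * ((Real.log ε : ℂ) + θ * I)) * ((Real.log ε : ℂ) + θ * I) *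
          kernel a ((ε : ℂ) * exp (θ * I)) * ((ε : ℂ) * I * exp (θ * I))) s := by
  have hk := continuous_kernel_circle a hε hε'
  refine (intervalIntegral.hasDerivAt_integral_of_dominated_loc_of_deriv_le
    (F := fun (s : ℂ) (θ : ℝ) => exp ((s - 1) * ((Real.log ε : ℂ) + θ * I)) *
      kernel a ((ε : ℂ) * exp (θ * I)) * ((ε : ℂ) * I * exp (θ * I)))
    (F' := fun (s : ℂ) (θ : ℝ) => exp ((s - 1) * ((Real.log ε : ℂ) + θ * I)) *
      ((Real.log ε : ℂ) + θ * I) *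
          kernel a ((ε : ℂ) * exp (θ * I)) * ((ε : ℂ) * I * exp (θ * I)))
    (bound := fun θ : ℝ => Real.exp ((‖s - 1‖ + 1) * ‖(Real.log ε : ℂ) + θ * I‖) *
      ‖((Real.log ε : ℂ) + θ * I) *
          kernel a ((ε : ℂ) * exp (θ * I)) * ((ε : ℂ) * I * exp (θ * I))‖)
    (Metric.ball_mem_nhds s one_pos) (Eventually.of_forall fun w => ?_) ?_ ?_ ?_ ?_ ?_).2
  · exact Continuous.aestronglyMeasurable (by fun_prop)
  · exact Continuous.intervalIntegrable (by fun_prop) _ _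
  · exact Continuous.aestronglyMeasurable (by fun_prop)
  · refine ae_of_all _ fun θ _ w hw => ?_
    rw [mul_assoc, mul_assoc, norm_mul, ← mul_assoc]
    gcongr
    rw [norm_exp]
    gcongr
    refine (re_le_norm _).trans ?_
    rw [norm_mul]
    gcongr
    have h1 : w - 1 = (s - 1) + (w - s) := by ring
    rw [h1]
    refine (norm_add_le _ _).trans ?_
    gcongr
    exact (mem_ball_iff_norm.1 hw).le
  · exact Continuous.intervalIntegrable (by fun_prop) _ _
  · refine ae_of_all _ fun θ _ w _ => ?_
    have h : HasDerivAt (fun s : ℂ => exp ((s - 1) * ((Real.log ε : ℂ) + θ * I)))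
        (exp ((w - 1) * ((Real.log ε : ℂ) + θ * I)) * ((Real.log ε : ℂ) + θ * I)) w := by
      simpa using (((hasDerivAt_id w).sub_const 1).mul_const ((Real.log ε : ℂ) + θ * I)).cexp
    exact (h.mul_const _).mul_const _

end Circle

theorem hankelIntegrable_kernel {a : ℂ} (ha : 0 < a.re) {ε : ℝ} (hε : 0 < ε)
    (hε' : ε < 2 * Real.pi) (s : ℂ) :
    HankelIntegrable ε fun z l => exp ((s - 1) * l) * kernel a z where
  lower := by simpa only [sub_eq_add_neg] using integrableOn_ray ha hε s (-(Real.pi * I))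
  circle := by
    have := continuous_kernel_circle a hε hε'
    exact Continuous.intervalIntegrable (by fun_prop) _ _
  upper := integrableOn_ray ha hε s (Real.pi * I)

theorem hankelIntegrable_log_kernel {a : ℂ} (ha : 0 < a.re) {ε : ℝ} (hε : 0 < ε)
    (hε' : ε < 2 * Real.pi) (s : ℂ) :
    HankelIntegrable ε fun z l => exp ((s - 1) * l) * l * kernel a z where
  lower := by simpa only [sub_eq_add_neg] using integrableOn_log_ray ha hε s (-(Real.pi * I))
  circle := by
    have := continuous_kernel_circle a hε hε'
    exact Continuous.intervalIntegrable (by fun_prop) _ _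
  upper := integrableOn_log_ray ha hε s (Real.pi * I)

theorem hasDerivAt_hankelIntegral {a : ℂ} (ha : 0 < a.re) {ε : ℝ} (hε : 0 < ε)
    (hε' : ε < 2 * Real.pi) (s : ℂ) :
    HasDerivAt (fun s => hankelIntegral ε fun z l => exp ((s - 1) * l) * kernel a z)
      (hankelIntegral ε fun z l => exp ((s - 1) * l) * l * kernel a z) s := by
  unfold hankelIntegral
  simp only [sub_eq_add_neg _ ((Real.pi : ℂ) * I)]
  exact ((hasDerivAt_integral_ray ha hε s _).add (hasDerivAt_integral_circle a hε hε' s)).sub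
    (hasDerivAt_integral_ray ha hε s _)

/-- Substituting `x = exp t` on a side of the cut. -/
theorem integral_ray_segment (a : ℂ) {ε δ : ℝ} (hε : 0 < ε) (hδ : 0 < δ) (s c : ℂ)
    (hc : exp c = -1) :
    ∫ x in ε..δ, exp ((s - 1) * ((Real.log x : ℂ) + c)) * kernel a (-(x : ℂ)) =
      -∫ t in (Real.log ε)..(Real.log δ), exp (s * (t + c)) * kernel a (exp (t + c)) := by
  have hpos : ∀ x ∈ Real.exp '' uIcc (Real.log ε) (Real.log δ), 0 < x := by
    rintro _ ⟨t, _, rfl⟩; exact Real.exp_pos t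
  have h := intervalIntegral.integral_deriv_smul_comp' (a := Real.log ε) (b := Real.log δ)
    (f := Real.exp) (f' := Real.exp)
    (g := fun x : ℝ => exp ((s - 1) * ((Real.log x : ℂ) + c)) * kernel a (-(x : ℂ)))
    (fun x _ => Real.hasDerivAt_exp x) Real.continuous_exp.continuousOn
    (ContinuousOn.mul (fun x hx => ContinuousAt.continuousWithinAt (by
      have := (hpos x hx).ne'
      have h2 := (Real.continuousAt_log this)
      fun_prop (disch := assumption)))
      ((continuousOn_kernel_neg a).mono hpos))
  rw [Real.exp_log hε, Real.exp_log hδ] at h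
  rw [← h, ← intervalIntegral.integral_neg]
  refine intervalIntegral.integral_congr fun t _ => ?_
  simp only [Function.comp, Real.log_exp, exp_add, hc, real_smul, ofReal_exp]
  have h3 : exp (s * (t + c)) = exp ((s - 1) * (t + c)) * (exp t * exp c) := by
    rw [← exp_add, ← exp_add]; ring_nf
  rw [h3, hc]; simp only [mul_neg_one]; ring

theorem hankelIntegral_eq_of_le {a : ℂ} (ha : 0 < a.re) {ε δ : ℝ} (hε : 0 < ε) (hεδ : ε ≤ δ)
    (hδ : δ < 2 * Real.pi) (s : ℂ) :
    (hankelIntegral ε fun z l => exp ((s - 1) * l) * kernel a z) =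
      hankelIntegral δ fun z l => exp ((s - 1) * l) * kernel a z := by
  have hδ0 := hε.trans_le hεδ
  have hray (c : ℂ) (hc : exp c = -1) :
      (∫ x : ℝ in Ioi ε, exp ((s - 1) * ((Real.log x : ℂ) + c)) * kernel a (-(x : ℂ))) -
        ∫ x : ℝ in Ioi δ, exp ((s - 1) * ((Real.log x : ℂ) + c)) * kernel a (-(x : ℂ)) =
      -∫ t in (Real.log ε)..(Real.log δ), exp (s * (t + c)) * kernel a (exp (t + c)) := by
    rw [intervalIntegral.integral_Ioi_sub_Ioi (integrableOn_ray ha hε s c) hεδ,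
      integral_ray_segment a hε hδ0 s c hc]
  have hcirc {r : ℝ} (hr : 0 < r) :
      (∫ θ : ℝ in (-Real.pi)..Real.pi,
        exp ((s - 1) * ((Real.log r : ℂ) + θ * I)) * kernel a ((r : ℂ) * exp (θ * I)) *
          ((r : ℂ) * I * exp (θ * I))) =
      I * ∫ θ : ℝ in (-Real.pi)..Real.pi, exp (s * ((Real.log r : ℂ) + θ * I)) *
        kernel a (exp ((Real.log r : ℂ) + θ * I)) := by
    rw [← intervalIntegral.integral_const_mul]
    refine intervalIntegral.integral_congr fun θ _ => ?_
    have h3 : exp (s * ((Real.log r : ℂ) + θ * I)) =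
        exp ((s - 1) * ((Real.log r : ℂ) + θ * I)) * exp ((Real.log r : ℂ) + θ * I) := by
      rw [← exp_add]; ring_nf
    simp only [h3, exp_log_add hr]; ring
  have hrect := integral_boundary_rect_eq_zero_of_differentiableOn
    (fun w => exp (s * w) * kernel a (exp w))
    ((Real.log ε : ℂ) + (-Real.pi : ℝ) * I) ((Real.log δ : ℂ) + (Real.pi : ℝ) * I) (by
      intro w hw
      have hre : w.re ≤ Real.log δ := by
        have := (mem_reProdIm.1 hw).1
        simp at this
        rw [uIcc_of_le (Real.log_le_log hε hεδ)] at this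
        exact this.2
      refine DifferentiableAt.differentiableWithinAt (DifferentiableAt.mul (by fun_prop) ?_)
      refine (differentiableAt_kernel a (one_sub_exp_ne_zero (exp_ne_zero w) ?_)).comp w
        (by fun_prop)
      rw [norm_exp]
      refine lt_of_le_of_lt ?_ hδ
      rwa [← Real.le_log_iff_exp_le hδ0])
  simp [-exp_add_pi_mul_I] at hrect
  have hl := hray (-(Real.pi * I)) (by rw [exp_neg, exp_pi_mul_I]; norm_num)
  have hu := hray (Real.pi * I) exp_pi_mul_I
  have h1 := hcirc hε
  have h2 := hcirc hδ0
  unfold hankelIntegral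
  simp only [sub_eq_add_neg _ ((Real.pi : ℂ) * I)]
  linear_combination hl - hu + h1 - h2 - hrect

theorem hankelIntegral_eq {a : ℂ} (ha : 0 < a.re) {ε δ : ℝ} (hε : 0 < ε) (hδ : 0 < δ)
    (hε' : ε < 2 * Real.pi) (hδ' : δ < 2 * Real.pi) (s : ℂ) :
    (hankelIntegral ε fun z l => exp ((s - 1) * l) * kernel a z) =
      hankelIntegral δ fun z l => exp ((s - 1) * l) * kernel a z := by
  rcases le_total ε δ with h | h
  · exact hankelIntegral_eq_of_le ha hε h hδ' s
  · exact (hankelIntegral_eq_of_le ha hδ h hε' s).symm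

theorem eventually_norm_kernel_mul_le (a : ℂ) : ∀ᶠ z in 𝓝[≠] 0, ‖kernel a z * z‖ ≤ 2 := by
  have h1 : Tendsto (fun z : ℂ => z⁻¹ * (exp z - 1)) (𝓝[≠] 0) (𝓝 1) := by
    simpa [hasDerivAt_iff_tendsto_slope_zero] using hasDerivAt_exp 0
  have h2 : Tendsto (fun z : ℂ => exp (a * z)) (𝓝[≠] 0) (𝓝 1) :=
    ((by fun_prop : Continuous fun z : ℂ => exp (a * z)).tendsto' 0 1 (by simp)).mono_left
      nhdsWithin_le_nhds
  have h3 := (h2.div h1 one_ne_zero).norm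
  simp only [div_one, norm_one] at h3
  filter_upwards [h3.eventually_le_const one_lt_two, self_mem_nhdsWithin] with z hz hz0
  have h4 : kernel a z * z = -(exp (a * z) / (z⁻¹ * (exp z - 1))) := by
    rw [kernel, div_mul_eq_mul_div, ← div_neg, ← mul_neg, neg_sub, div_eq_mul_inv, div_eq_mul_inv,
      mul_inv, inv_inv]
    ring
  rw [h4, norm_neg]
  exact hz

theorem tendsto_integral_circle (a : ℂ) {s : ℂ} (hs : 1 < s.re) :
    Tendsto (fun ε : ℝ => ∫ θ : ℝ in (-Real.pi)..Real.pi,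
        exp ((s - 1) * ((Real.log ε : ℂ) + θ * I)) * kernel a ((ε : ℂ) * exp (θ * I)) *
          ((ε : ℂ) * I * exp (θ * I))) (𝓝[>] 0) (𝓝 0) := by
  obtain ⟨r, hr, hr2⟩ := Metric.mem_nhdsWithin_iff.1 (eventually_norm_kernel_mul_le a)
  have hlim : Tendsto (fun ε : ℝ => ε ^ (s.re - 1) * Real.exp (|s.im| * Real.pi) * 2 *
      |Real.pi - -Real.pi|) (𝓝[>] 0) (𝓝 0) := by
    have h : Tendsto (fun ε : ℝ => ε ^ (s.re - 1)) (𝓝[>] 0) (𝓝 0) := by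
      have := (Real.continuousAt_rpow_const 0 (s.re - 1) (Or.inr (by linarith))).tendsto
      rw [Real.zero_rpow (by linarith)] at this
      exact this.mono_left nhdsWithin_le_nhds
    simpa using ((h.mul_const (Real.exp (|s.im| * Real.pi))).mul_const 2).mul_const
      |Real.pi - -Real.pi|
  refine squeeze_zero_norm' ?_ hlim
  filter_upwards [Ioo_mem_nhdsGT hr] with ε hε
  refine intervalIntegral.norm_integral_le_of_norm_le_const fun θ hθ => ?_
  rw [uIoc_of_le (by linarith [Real.pi_pos])] at hθ
  have hk : ‖kernel a ((ε : ℂ) * exp (θ * I)) * ((ε : ℂ) * exp (θ * I))‖ ≤ 2 := by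
    refine hr2 ⟨?_, ?_⟩
    · rw [mem_ball_zero_iff, norm_mul, norm_exp_ofReal_mul_I, norm_real, Real.norm_eq_abs,
        abs_of_pos hε.1, mul_one]
      exact hε.2
    · exact mul_ne_zero (ofReal_ne_zero.2 hε.1.ne') (exp_ne_zero _)
  have he : ‖exp ((s - 1) * ((Real.log ε : ℂ) + θ * I))‖ ≤
      ε ^ (s.re - 1) * Real.exp (|s.im| * Real.pi) := by
    rw [norm_exp, Real.rpow_def_of_pos hε.1, ← Real.exp_add]
    gcongr
    have h1 : ((s - 1) * ((Real.log ε : ℂ) + θ * I)).re =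
        Real.log ε * (s.re - 1) + -(s.im * θ) := by
      simp; ring
    rw [h1]
    gcongr
    refine (neg_le_abs _).trans ?_
    rw [abs_mul]
    gcongr
    exact abs_le.2 ⟨hθ.1.le, hθ.2⟩
  calc _ = ‖exp ((s - 1) * ((Real.log ε : ℂ) + θ * I))‖ *
        ‖kernel a ((ε : ℂ) * exp (θ * I)) * ((ε : ℂ) * exp (θ * I))‖ := by
        simp only [norm_mul, norm_I]; ring
    _ ≤ _ := mul_le_mul he hk (norm_nonneg _) ((norm_nonneg _).trans he)

/-- Collapsing the contour onto the cut. -/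
theorem hankelIntegral_eq_sin_mul_mellin {a : ℂ} (ha : 0 < a.re) {ε : ℝ} (hε : 0 < ε)
    (hε' : ε < 2 * Real.pi) {s : ℂ} (hs : 1 < s.re) :
    (hankelIntegral ε fun z l => exp ((s - 1) * l) * kernel a z) =
      2 * I * sin (Real.pi * s) * mellin (fun x : ℝ => kernel a (-(x : ℂ))) s := by
  have hm := tendsto_mellin_cutKernel ha hs
  have h1 := (((hm.const_mul (exp ((s - 1) * -(Real.pi * I)))).add
    (tendsto_integral_circle a hs)).sub (hm.const_mul (exp ((s - 1) * (Real.pi * I)))))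
  have h2 : ∀ᶠ δ : ℝ in 𝓝[>] 0, (hankelIntegral ε fun z l => exp ((s - 1) * l) * kernel a z) =
      exp ((s - 1) * -(Real.pi * I)) * mellin (cutKernel a δ) s +
      (∫ θ : ℝ in (-Real.pi)..Real.pi,
        exp ((s - 1) * ((Real.log δ : ℂ) + θ * I)) * kernel a ((δ : ℂ) * exp (θ * I)) *
          ((δ : ℂ) * I * exp (θ * I))) -
      exp ((s - 1) * (Real.pi * I)) * mellin (cutKernel a δ) s := by
    filter_upwards [Ioo_mem_nhdsGT Real.two_pi_pos] with δ hδ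
    rw [hankelIntegral_eq ha hε hδ.1 hε' hδ.2, hankelIntegral]
    simp only [sub_eq_add_neg _ ((Real.pi : ℂ) * I)]
    rw [integral_ray a hδ.1, integral_ray a hδ.1]
  have h3 := tendsto_nhds_unique (tendsto_const_nhds.congr' h2) h1
  have e1 : exp ((s - 1) * -(Real.pi * I)) = -exp (-(Real.pi * s) * I) := by
    rw [show (s - 1) * -(Real.pi * I) = -(Real.pi * s) * I + Real.pi * I by ring, exp_add,
      exp_pi_mul_I, mul_neg_one]
  have e2 : exp ((s - 1) * (Real.pi * I)) = -exp (Real.pi * s * I) := by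
    rw [show (s - 1) * (Real.pi * I) = Real.pi * s * I - Real.pi * I by ring, exp_sub,
      exp_pi_mul_I, div_neg, div_one]
  rw [h3, e1, e2, sin]
  linear_combination (-(exp (-(Real.pi * s) * I) - exp (Real.pi * s * I)) *
    mellin (fun x : ℝ => kernel a (-(x : ℂ))) s) * I_sq

theorem Gamma_one_sub_ne_zero_iff {s : ℂ} :
    Gamma (1 - s) ≠ 0 ↔ ∀ m : ℕ, s ≠ (m : ℂ) + 1 := by
  rw [Ne, Gamma_eq_zero_iff, not_exists]
  refine forall_congr' fun m => not_congr ⟨fun h => ?_, fun h => ?_⟩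
  · linear_combination -h
  · linear_combination -h

theorem differentiableAt_Gamma_one_sub {s : ℂ} (hs : ∀ m : ℕ, s ≠ (m : ℂ) + 1) :
    DifferentiableAt ℂ Gamma (1 - s) :=
  differentiableAt_Gamma _ fun m h => hs m (by linear_combination -h)

theorem isOpen_ne_nat_add_one : IsOpen {s : ℂ | ∀ m : ℕ, s ≠ (m : ℂ) + 1} := by
  have h : Continuous fun s : ℂ => (Gamma (1 - s))⁻¹ :=
    differentiable_one_div_Gamma.continuous.comp (by fun_prop)
  have h2 : {s : ℂ | ∀ m : ℕ, s ≠ (m : ℂ) + 1} = {s : ℂ | (Gamma (1 - s))⁻¹ ≠ 0} := by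
    ext s
    exact Gamma_one_sub_ne_zero_iff.symm.trans (not_congr inv_eq_zero).symm
  rw [h2]
  exact isOpen_ne_fun h continuous_const

theorem Gamma_mul_hankelIntegral {a : ℂ} (ha : 0 < a.re) {ε : ℝ} (hε : 0 < ε)
    (hε' : ε < 2 * Real.pi) {s : ℂ} (hs : 1 < s.re) (hs' : ∀ m : ℕ, s ≠ (m : ℂ) + 1) :
    Gamma (1 - s) / (2 * Real.pi * I) *
        (hankelIntegral ε fun z l => exp ((s - 1) * l) * kernel a z) =
      mellin (fun x : ℝ => kernel a (-(x : ℂ))) s / Gamma s := by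
  have hG : Gamma s ≠ 0 := Gamma_ne_zero_of_re_pos (by linarith)
  have hG' := Gamma_one_sub_ne_zero_iff.2 hs'
  have hr := Gamma_mul_Gamma_one_sub s
  have hsin : sin (Real.pi * s) ≠ 0 := by
    intro h
    rw [h, div_zero] at hr
    exact mul_ne_zero hG hG' hr
  have hpi : (Real.pi : ℂ) ≠ 0 := ofReal_ne_zero.2 Real.pi_ne_zero
  rw [hankelIntegral_eq_sin_mul_mellin ha hε hε' hs]
  rw [eq_div_iff hsin] at hr
  rw [div_mul_eq_mul_div, div_eq_div_iff (by simp [hpi]) hG]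
  linear_combination (2 * I * mellin (fun x : ℝ => kernel a (-(x : ℂ))) s) * hr

theorem exists_isHurwitzContinuation {a : ℂ} (ha : 0 < a.re) :
    ∃ Z : ℂ → ℂ, IsHurwitzContinuation a Z ∧ ∀ s : ℂ, (∀ m : ℕ, s ≠ (m : ℂ) + 1) →
      Z s = Gamma (1 - s) / (2 * Real.pi * I) *
        hankelIntegral 1 fun z l => exp ((s - 1) * l) * kernel a z := by
  classical
  have h1 : (1 : ℝ) < 2 * Real.pi := by linarith [Real.pi_gt_three]
  set M : ℂ → ℂ := fun s => mellin (fun x : ℝ => kernel a (-(x : ℂ))) s / Gamma s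
  set H : ℂ → ℂ := fun s => Gamma (1 - s) / (2 * Real.pi * I) *
    hankelIntegral 1 fun z l => exp ((s - 1) * l) * kernel a z
  set Z : ℂ → ℂ := fun s => if 1 < s.re then M s else H s
  have hZM {s : ℂ} (hs : 1 < s.re) : Z s = M s := if_pos hs
  have hZH {s : ℂ} (hs : ∀ m : ℕ, s ≠ (m : ℂ) + 1) : Z s = H s := by
    by_cases h : 1 < s.re
    · rw [hZM h]
      exact (Gamma_mul_hankelIntegral ha one_pos h1 h hs).symm
    · exact if_neg h
  refine ⟨Z, ⟨fun s hs => DifferentiableAt.differentiableWithinAt ?_, fun s hs => ?_⟩,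
    fun s hs => hZH hs⟩
  · by_cases h : 1 < s.re
    · have hM : DifferentiableAt ℂ M s := by
        refine (differentiableAt_mellin_kernel ha h).div (differentiableAt_Gamma s fun m hm => ?_)
          (Gamma_ne_zero_of_re_pos (by linarith))
        rw [hm, neg_re, natCast_re] at h
        linarith [(Nat.cast_nonneg m : (0 : ℝ) ≤ m)]
      refine hM.congr_of_eventuallyEq ?_
      filter_upwards [(isOpen_lt continuous_const continuous_re).mem_nhds h] with w hw
      exact hZM hw
    · have hs' : ∀ m : ℕ, s ≠ (m : ℂ) + 1 := by
        rintro m rfl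
        rw [add_re, natCast_re, one_re, not_lt] at h
        have hm : m = 0 := by
          have : (m : ℝ) ≤ 0 := by linarith
          exact_mod_cast le_antisymm this (Nat.cast_nonneg m)
        simp [hm] at hs
      have hH : DifferentiableAt ℂ H s := by
        refine DifferentiableAt.mul (DifferentiableAt.div_const ?_ _)
          (hasDerivAt_hankelIntegral ha one_pos h1 s).differentiableAt
        exact (differentiableAt_Gamma_one_sub hs').comp s (by fun_prop)
      refine hH.congr_of_eventuallyEq ?_
      filter_upwards [isOpen_ne_nat_add_one.mem_nhds hs'] with w hw
      exact hZH hw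
  · rw [hZM hs]
    have hG : Gamma s ≠ 0 := Gamma_ne_zero_of_re_pos (by linarith)
    have h := (hasSum_mellin_kernel ha hs).div_const (Gamma s)
    simpa only [mul_div_cancel_left₀ _ hG] using h

theorem isHurwitzContinuation_hurwitzZeta {a : ℂ} (ha : 0 < a.re) :
    IsHurwitzContinuation a (hurwitzZeta a) := by
  have h : ∃ Z : ℂ → ℂ, IsHurwitzContinuation a Z :=
    (exists_isHurwitzContinuation ha).imp fun _ hZ => hZ.1
  rw [hurwitzZeta, dif_pos h]
  exact h.choose_spec

theorem hurwitzZeta_eq_hankelIntegral {a : ℂ} (ha : 0 < a.re) {ε : ℝ} (hε : 0 < ε)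
    (hε' : ε < 2 * Real.pi) {s : ℂ} (hs : ∀ m : ℕ, s ≠ (m : ℂ) + 1) :
    hurwitzZeta a s = Gamma (1 - s) / (2 * Real.pi * I) *
      hankelIntegral ε fun z l => exp ((s - 1) * l) * kernel a z := by
  obtain ⟨Z, hZ, h⟩ := exists_isHurwitzContinuation ha
  rw [(isHurwitzContinuation_hurwitzZeta ha).eqOn hZ (by simpa using hs 0), h s hs,
    hankelIntegral_eq ha hε one_pos hε' (by linarith [Real.pi_gt_three])]

theorem hankelIntegral_eq_sin_mul_hurwitzZeta {a : ℂ} (ha : 0 < a.re) {ε : ℝ} (hε : 0 < ε)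
    (hε' : ε < 2 * Real.pi) {s : ℂ} (hs : 1 < s.re) :
    (hankelIntegral ε fun z l => exp ((s - 1) * l) * kernel a z) =
      2 * I * sin (Real.pi * s) * (Gamma s * hurwitzZeta a s) := by
  rw [hankelIntegral_eq_sin_mul_mellin ha hε hε' hs, (hasSum_mellin_kernel ha hs).unique
    (((isHurwitzContinuation_hurwitzZeta ha).hasSum s hs).mul_left (Gamma s))]

theorem deriv_hurwitzZeta_add_digamma_mul {a : ℂ} (ha : 0 < a.re) {ε : ℝ} (hε : 0 < ε)
    (hε' : ε < 2 * Real.pi) {s : ℂ} (hs : ∀ m : ℕ, s ≠ (m : ℂ) + 1) :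
    deriv (hurwitzZeta a) s + digamma (1 - s) * hurwitzZeta a s =
      Gamma (1 - s) / (2 * Real.pi * I) *
        hankelIntegral ε fun z l => exp ((s - 1) * l) * l * kernel a z := by
  have hG := (differentiableAt_Gamma_one_sub hs).hasDerivAt
  have hG2 : HasDerivAt (fun s => Gamma (1 - s)) (-deriv Gamma (1 - s)) s := by
    simpa using hG.comp_const_sub 1 s
  have hd := ((hG2.div_const (2 * Real.pi * I)).mul
    (hasDerivAt_hankelIntegral ha hε hε' s)).congr_of_eventuallyEq (f₁ := hurwitzZeta a) (by
      filter_upwards [isOpen_ne_nat_add_one.mem_nhds hs] with w hw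
      exact hurwitzZeta_eq_hankelIntegral ha hε hε' hw)
  rw [hd.deriv, hurwitzZeta_eq_hankelIntegral ha hε hε' hs, digamma_def, logDeriv_apply]
  have := Gamma_one_sub_ne_zero_iff.2 hs
  field_simp
  ring

theorem hurwitzZeta_nat_add_one {a : ℂ} (ha : 0 < a.re) {ε : ℝ} (hε : 0 < ε)
    (hε' : ε < 2 * Real.pi) {n : ℕ} (hn : 1 ≤ n) :
    hurwitzZeta a ((n : ℂ) + 1) =
      (-1) ^ (n + 1) / (2 * Real.pi * I * (n.factorial : ℂ)) *
        hankelIntegral ε fun z l => exp ((n : ℂ) * l) * l * kernel a z := by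
  have hs : 1 < ((n : ℂ) + 1).re := by
    have : (1 : ℝ) ≤ n := by exact_mod_cast hn
    simp; linarith
  have hz : DifferentiableAt ℂ (hurwitzZeta a) ((n : ℂ) + 1) := by
    refine (isHurwitzContinuation_hurwitzZeta ha).differentiableOn.differentiableAt
      (isOpen_compl_singleton.mem_nhds ?_)
    simp; lia
  have hG : DifferentiableAt ℂ Gamma ((n : ℂ) + 1) :=
    differentiableAt_Gamma _ fun m hm => by
      rw [hm, neg_re, natCast_re] at hs
      linarith [(Nat.cast_nonneg m : (0 : ℝ) ≤ m)]
  have hsin : HasDerivAt (fun s : ℂ => 2 * I * sin (Real.pi * s))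
      (2 * I * (cos (Real.pi * ((n : ℂ) + 1)) * Real.pi)) ((n : ℂ) + 1) := by
    have := (hasDerivAt_sin (Real.pi * ((n : ℂ) + 1))).comp ((n : ℂ) + 1)
      ((hasDerivAt_id ((n : ℂ) + 1)).const_mul (Real.pi : ℂ))
    simpa using! this.const_mul (2 * I)
  have hd := (hsin.mul (hG.mul hz).hasDerivAt).congr_of_eventuallyEq
    (f₁ := fun s => hankelIntegral ε fun z l => exp ((s - 1) * l) * kernel a z) (by
      filter_upwards [(isOpen_lt continuous_const continuous_re).mem_nhds hs] with w hw
      exact hankelIntegral_eq_sin_mul_hurwitzZeta ha hε hε' hw)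
  have h := (hasDerivAt_hankelIntegral ha hε hε' ((n : ℂ) + 1)).unique hd
  have e1 : sin (Real.pi * ((n : ℂ) + 1)) = 0 := by
    have := sin_nat_mul_pi (n + 1)
    push_cast at this
    rwa [mul_comm]
  have e2 : cos (Real.pi * ((n : ℂ) + 1)) = (-1) ^ (n + 1) := by
    have := congrArg ((↑) : ℝ → ℂ) (Real.cos_nat_mul_pi (n + 1))
    push_cast at this
    rwa [mul_comm]
  rw [e1, e2] at h
  simp only [add_sub_cancel_right, Pi.mul_apply, Gamma_nat_eq_factorial] at h
  rw [h]
  have hpi : (Real.pi : ℂ) ≠ 0 := ofReal_ne_zero.2 Real.pi_ne_zero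
  have hf : (n.factorial : ℂ) ≠ 0 := Nat.cast_ne_zero.2 n.factorial_ne_zero
  have hp : ((-1 : ℂ) ^ (n + 1)) * (-1) ^ (n + 1) = 1 := by rw [← mul_pow]; simp
  rw [div_mul_eq_mul_div, eq_div_iff (by simp [hpi, hf])]
  linear_combination (-2 * Real.pi * I * n.factorial * hurwitzZeta a ((n : ℂ) + 1)) * hp

theorem neg_nat_ne_nat_add_one (n m : ℕ) : (-(n : ℂ)) ≠ (m : ℂ) + 1 := fun h => by
  have : (n : ℂ) + m + 1 = 0 := by linear_combination -h
  exact Nat.cast_add_one_ne_zero (R := ℂ) (n + m) (by push_cast; exact this)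

theorem exp_zpow_neg_sub_one (n : ℕ) (l : ℂ) :
    exp l ^ (-(n : ℤ) - 1) = exp ((-(n : ℂ) - 1) * l) := by
  rw [← exp_int_mul]; push_cast; rfl

end HankelZeta

theorem lemma1 (a : ℂ) (ha : 0 < a.re) :
    -- `ζ(·, a)` really is the analytic continuation of its series to `s ≠ 1`
    HankelZeta.IsHurwitzContinuation a (HankelZeta.hurwitzZeta a) ∧
    -- the radius of the circular part of the contour is arbitrary in `(0, 2π)`
    ∀ ε : ℝ, 0 < ε → ε < 2 * Real.pi →
      (∀ n : ℕ,
        HankelZeta.HankelIntegrable ε (fun z _ =>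
          z ^ (-(n : ℤ) - 1) * Complex.exp (a * z) / (1 - Complex.exp z)) ∧
        HankelZeta.hurwitzZeta a (-(n : ℂ)) =
          (n.factorial : ℂ) / (2 * Real.pi * Complex.I) *
            HankelZeta.hankelIntegral ε (fun z _ =>
              z ^ (-(n : ℤ) - 1) * Complex.exp (a * z) / (1 - Complex.exp z))) ∧
      (∀ n : ℕ, 1 ≤ n →
        HankelZeta.HankelIntegrable ε (fun z l =>
          z ^ n * l * Complex.exp (a * z) / (1 - Complex.exp z)) ∧
        HankelZeta.hurwitzZeta a ((n : ℂ) + 1) =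
          (-1) ^ (n + 1) / (2 * Real.pi * Complex.I * (n.factorial : ℂ)) *
            HankelZeta.hankelIntegral ε (fun z l =>
              z ^ n * l * Complex.exp (a * z) / (1 - Complex.exp z))) ∧
      (∀ s : ℂ, (∀ m : ℕ, s ≠ (m : ℂ) + 1) →
        HankelZeta.HankelIntegrable ε (fun z l =>
          Complex.exp ((s - 1) * l) * Complex.exp (a * z) * l / (1 - Complex.exp z)) ∧
        deriv (HankelZeta.hurwitzZeta a) s +
            Complex.digamma (1 - s) * HankelZeta.hurwitzZeta a s =
          Complex.Gamma (1 - s) / (2 * Real.pi * Complex.I) *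
            HankelZeta.hankelIntegral ε (fun z l =>
              Complex.exp ((s - 1) * l) * Complex.exp (a * z) * l / (1 - Complex.exp z))) ∧
      (∀ n : ℕ,
        HankelZeta.HankelIntegrable ε (fun z l =>
          z ^ (-(n : ℤ) - 1) * Complex.exp (a * z) * l / (1 - Complex.exp z)) ∧
        HankelZeta.g n a =
          (n.factorial : ℂ) / (2 * Real.pi * Complex.I) *
            HankelZeta.hankelIntegral ε (fun z l =>
              z ^ (-(n : ℤ) - 1) * Complex.exp (a * z) * l / (1 - Complex.exp z))) := by
  refine ⟨HankelZeta.isHurwitzContinuation_hurwitzZeta ha, fun ε hε hε' => ⟨fun n => ?_,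
    fun n hn => ?_, fun s hs => ?_, fun n => ?_⟩⟩
  · have h (l : ℂ) : Complex.exp ((-(n : ℂ) - 1) * l) * HankelZeta.kernel a (Complex.exp l) =
        Complex.exp l ^ (-(n : ℤ) - 1) * Complex.exp (a * Complex.exp l) /
          (1 - Complex.exp (Complex.exp l)) := by
      rw [HankelZeta.exp_zpow_neg_sub_one, HankelZeta.kernel, mul_div_assoc]
    refine ⟨(HankelZeta.hankelIntegrable_kernel ha hε hε' (-(n : ℂ))).congr hε h, ?_⟩
    rw [HankelZeta.hurwitzZeta_eq_hankelIntegral ha hε hε' (HankelZeta.neg_nat_ne_nat_add_one n),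
      sub_neg_eq_add, add_comm (1 : ℂ), Complex.Gamma_nat_eq_factorial]
    exact congrArg _ (HankelZeta.hankelIntegral_congr hε h)
  · have h (l : ℂ) : Complex.exp ((n : ℂ) * l) * l * HankelZeta.kernel a (Complex.exp l) =
        Complex.exp l ^ n * l * Complex.exp (a * Complex.exp l) /
          (1 - Complex.exp (Complex.exp l)) := by
      rw [Complex.exp_nat_mul, HankelZeta.kernel, mul_div_assoc]
    have hi := HankelZeta.hankelIntegrable_log_kernel ha hε hε' ((n : ℂ) + 1)
    simp only [add_sub_cancel_right] at hi
    refine ⟨hi.congr hε h, ?_⟩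
    rw [HankelZeta.hurwitzZeta_nat_add_one ha hε hε' hn]
    exact congrArg _ (HankelZeta.hankelIntegral_congr hε h)
  · have h (l : ℂ) : Complex.exp ((s - 1) * l) * l * HankelZeta.kernel a (Complex.exp l) =
        Complex.exp ((s - 1) * l) * Complex.exp (a * Complex.exp l) * l /
          (1 - Complex.exp (Complex.exp l)) := by
      rw [HankelZeta.kernel]; ring
    refine ⟨(HankelZeta.hankelIntegrable_log_kernel ha hε hε' s).congr hε h, ?_⟩
    rw [HankelZeta.deriv_hurwitzZeta_add_digamma_mul ha hε hε' hs]
    exact congrArg _ (HankelZeta.hankelIntegral_congr hε h)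
  · have h (l : ℂ) : Complex.exp ((-(n : ℂ) - 1) * l) * l * HankelZeta.kernel a (Complex.exp l) =
        Complex.exp l ^ (-(n : ℤ) - 1) * Complex.exp (a * Complex.exp l) * l /
          (1 - Complex.exp (Complex.exp l)) := by
      rw [HankelZeta.exp_zpow_neg_sub_one, HankelZeta.kernel]; ring
    refine ⟨(HankelZeta.hankelIntegrable_log_kernel ha hε hε' (-(n : ℂ))).congr hε h, ?_⟩
    have hd := HankelZeta.deriv_hurwitzZeta_add_digamma_mul ha hε hε'
      (HankelZeta.neg_nat_ne_nat_add_one n)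
    rw [sub_neg_eq_add, add_comm (1 : ℂ), Complex.Gamma_nat_eq_factorial] at hd
    exact hd.trans (congrArg _ (HankelZeta.hankelIntegral_congr hε h))
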